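/- Let $D\subset\mathbb R^d$ ($d\ge1$) be a bounded polyhedral domain and let $(\varphi_i)_{i\in\mathcal V}$ be a finite family of nonnegative Lipschitz shape functions on $\overline D$, none identically zero, with $\sum_i\varphi_i=1$ (e.g. continuous Lagrange finite elements). Set $\mathcal I(i)=\{j:|\operatorname{supp}\varphi_j\cap\operatorname{supp}\varphi_i|\ne0\}$, $\mathcal I^*(i)=\mathcal I(i)\setminus\{i\}$, $m_i=\int_D\varphi_i$, $m_{ij}=\int_D\varphi_i\varphi_j$, $c_{ij}=\int_D\varphi_i\nabla\varphi_j$, $n_{ij}=c_{ij}/\|c_{ij}\|$, $b_{ij}=\delta_{ij}-m_{ij}/m_j$, $\lambda_i=(\operatorname{card}\mathcal I(i)-1)^{-1}$. States are $U=(\rho,M,E)\in\mathbb R^{d+2}$, with velocity $v=M/\rho$, $e=E/\rho-\tfrac12\|v\|^2$, $p=(\gamma-1)\rho e$ with $\gamma>1$, sound speed $a=\sqrt{\gamma p/\rho}$, and flux $f(U)=(M,\,v\otimes M+pI,\,v(E+p))$. A state is *admissible* if $\rho>0$ and $e>0$; a family of nodal states is admissible if each of them is. **Forward-Euler step with convex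 limiting**, applied to $(U_i)$ with time step $\tau$. For $j\in\mathcal I^*(i)$ let $d^L_{ij}=\max(\hat\lambda(U_i,U_j,n_{ij})\|c_{ij}\|,\hat\lambda(U_j,U_i,n_{ji})\|c_{ji}\|)$, where, for admissible $U_L,U_R$ and unit $n$, $\hat\lambda(U_L,U_R,n)$ is any upper bound on the maximum wave speed of the Riemann problem with data $U_L,U_R$ and flux $f(\cdot)n$; let $d^L_{ii}=-\sum_{j\in\mathcal I^*(i)}d^L_{ij}$ and $d^H_{ij}=\frac{\alpha_i+\alpha_j}2d^L_{ij}$ with arbitrary indicators $\alpha_i\in[0,1]$. Put $U^L_i=U_i+\frac{\tau}{m_i}\sum_{j\in\mathcal I(i)}\big(-f(U_j)c_{ij}+d^L_{ij}(U_j-U_i)\big)$, $F^H_i=\sum_{j\in\mathcal I(i)}\big(-f(U_j)c_{ij}+d^H_{ij}(U_j-U_i)\big)$, $\overline U_{ij}=\frac12(U_i+U_j)-\frac1{2d^L_{ij}}(f(U_j)-f(U_i))c_{ij}$ and $$P_{ij}=\tfrac{\tau}{m_i\lambda_i}\big(b_{ij}F^H_j-b_{ji}F^H_i+(d^H_{ij}-d^L_{ij})(U_j-U_i)\big).$$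 (Quotients with zero denominator are read as $0$, so that a zero vector is normalized to $0$ and $\overline U_{ij}=\frac12(U_i+U_j)$ if $d^L_{ij}=0$.) Starting from $W_i=U^L_i$, each limiter pass replaces $W_i$ by $W_i+\sum_{j\in\mathcal I^*(i)}\lambda_i\ell_{ij}P_{ij}$ and $P_{ij}$ by $(1-\ell_{ij})P_{ij}$, where $\ell_{ij}=\min(\ell^i_j,\ell^j_i)$ and $\ell^i_j\ge0$ is the largest number in $[0,1]$ (or a lower estimate of it; it is $0$ if there is no such number) for which $W_i+\ell^i_jP_{ij}$ has density between $\min_{j\in\mathcal I(i)}\rho(\overline U_{ij})$ and $\max_{j\in\mathcal I(i)}\rho(\overline U_{ij})$ and satisfies $\Phi\ge\min_{j\in\mathcal I(i)}\Phi(U_j)$, with $\Phi(U)=\big(E-\frac{\|M\|^2}{2\rho}\big)\rho^{-\gamma}$. The result $\mathcal E_\tau(U)$ is $W$ after a fixed number of passes. **Boundary post-processing** $\mathcal P_t$. The boundary $\partial D$, with outward unit normal $n$, is split into a slip part and its complement, the non-reflecting part. Let $n^s_i$ (resp. $n^{nr}_i$) be the normalization of $\int\varphi_i\,n\,ds$ over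 the slip (resp. non-reflecting) part. At nodes $i$ with $\varphi_i\not\equiv0$ on the slip part, $M_i$ is replaced by $M_i-(M_i\cdot n_i^s)n_i^s$. At nodes with $\varphi_i\not\equiv0$ on the non-reflecting part, where an admissible Dirichlet state $U^D=U^D_i(t)$ is given, and with $n=n_i^{nr}$, $U=U_i$, $V_n=v\cdot n$, $v^\perp=v-V_nn$, $C_1=V_n-\frac{2a}{\gamma-1}$, $C_3=V_n+\frac{2a}{\gamma-1}$, $S=p\rho^{-\gamma}$, one of the following is used (both boundary operations, in either order, at nodes of both types): * Godunov's method: $U$ is replaced by the value at $x=0$ of the solution of the Riemann problem with left state $U$, right state $U^D$ and flux $f(\cdot)n$. It is assumed that $x=0$ is not in a vacuum region, i.e. that $C_3(U)>0$ or $C_1(U^D)<0$. * Characteristic variables: $U$ is replaced by $U^D$ if $V_n+a<0$; it is kept if $V_n\ge0$ and $V_n-a\ge0$; otherwise it is replaced by the state $U^P$ with $C_1(U^P)=C_1(U^D)$, $C_3(U^P)=C_3(U)$, and with $S$ and $v^\perp$ taken from $U^D$ if $V_n<0$ and from $U$ if $V_n\ge0$; that is, $\rho^P=\big(\frac1{\gamma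 S}(\frac{\gamma-1}4(C_3(U)-C_1(U^D)))^2\big)^{1/(\gamma-1)}$, $V_n^P=\frac12(C_1(U^D)+C_3(U))$, $p^P=S(\rho^P)^\gamma$. It is assumed that $\gamma\le3$ and $\frac{\gamma-1}2V_n^D\le a^D$, with strict inequality if $\gamma=3$. **Claim.** Let $U^n$ be admissible, let $\tau>0$, and set $$W^{(1)}=\mathcal P_{t+\tau}\big(\mathcal E_\tau(U^n)\big),\quad W^{(2)}=\mathcal P_{t+\tau/2}\big(\tfrac34U^n+\tfrac14\mathcal E_\tau(W^{(1)})\big),\quad U^{n+1}=\mathcal P_{t+\tau}\big(\tfrac13U^n+\tfrac23\mathcal E_\tau(W^{(2)})\big)$$ (the SSPRK(3,3) step). Suppose that the CFL condition $\tau\le c_{\rm cfl}\min_i\frac{m_i}{2|d^L_{ii}|}$, with $0<c_{\rm cfl}\le1$ (nodes with $d^L_{ii}=0$ imposing no restriction), holds at each of the three forward-Euler steps, $d^L$ being computed from $U^n$, $W^{(1)}$, $W^{(2)}$ respectively. Then $U^{n+1}$ is admissible. -/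

import Mathlib

open MeasureTheory
open scoped Gradient

noncomputable section

namespace EulerFE

/-- Points and vectors of the physical space `ℝ^d`. -/
abbrev Pt (d : ℕ) := EuclideanSpace ℝ (Fin d)

/-- Conserved states `(ρ, m, E) ∈ ℝ × ℝ^d × ℝ = ℝ^(d+2)`. -/
abbrev State (d : ℕ) := ℝ × Pt d × ℝ

/-! ### States, the `γ`-law, the admissible set and the Euler flux -/

variable {d : ℕ}

def density (U : State d) : ℝ := U.1
def momentum (U : State d) : Pt d := U.2.1
def totalEnergy (U : State d) : ℝ := U.2.2

def velocity (U : State d) : Pt d := (density U)⁻¹ • momentum U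

/-- Specific internal energy `e = E/ρ - ½ ‖m/ρ‖²`. -/
def specificInternalEnergy (U : State d) : ℝ :=
  (density U)⁻¹ * totalEnergy U - 1 / 2 * ‖velocity U‖ ^ 2

/-- Internal energy `ε = E - ‖m‖² / (2ρ)`. -/
def internalEnergy (U : State d) : ℝ :=
  totalEnergy U - ‖momentum U‖ ^ 2 / (2 * density U)

/-- The set of admissible states: positive density and positive specific internal energy. -/
def admissible (d : ℕ) : Set (State d) :=
  {U | 0 < density U ∧ 0 < specificInternalEnergy U}

/-- Pressure of the `γ`-law, `p = (γ - 1) ρ e`. -/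
def pressure (γ : ℝ) (U : State d) : ℝ := (γ - 1) * density U * specificInternalEnergy U

/-- Speed of sound. -/
def soundSpeed (γ : ℝ) (U : State d) : ℝ := √(γ * pressure γ U / density U)

/-- `S(U) = ρ^(-γ) p`. -/
def entropyS (γ : ℝ) (U : State d) : ℝ := (density U) ^ (-γ) * pressure γ U

/-- The limited functional `Φ(U) = ε ρ^(-γ)`. -/
def entropyPhi (γ : ℝ) (U : State d) : ℝ := internalEnergy U * (density U) ^ (-γ)

/-- The Euler flux contracted with a vector: `f(U) c`, where
`f(U) = (m, v ⊗ m + p I, v (E + p))`. -/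
def flux (γ : ℝ) (U : State d) (c : Pt d) : State d :=
  (inner ℝ (momentum U) c,
   inner ℝ (velocity U) c • momentum U + pressure γ U • c,
   inner ℝ (velocity U) c * (totalEnergy U + pressure γ U))

/-- Component of the velocity along `n`. -/
def normalVelocity (n : Pt d) (U : State d) : ℝ := inner ℝ (velocity U) n

/-- Component of the velocity orthogonal to `n`. -/
def tangentialVelocity (n : Pt d) (U : State d) : Pt d := velocity U - normalVelocity n U • n

/-- The conserved state with density `ρ`, velocity `v` and pressure `p` (`γ`-law). -/
def ofPrimitive (γ ρ : ℝ) (v : Pt d) (p : ℝ) : State d :=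
  (ρ, ρ • v, p / (γ - 1) + 1 / 2 * ‖ρ • v‖ ^ 2 / ρ)

/-! ### The exact Riemann problem `∂ₜ u + ∂ₓ (f(u) n) = 0` for the `γ`-law -/

/-- Change of normal velocity through the wave (a shock if `p > p_Z`, a rarefaction otherwise)
joining the state `Z` to a state of pressure `p`. -/
def waveCurve (γ : ℝ) (Z : State d) (p : ℝ) : ℝ :=
  if pressure γ Z < p then
    (p - pressure γ Z) *
      √((2 / ((γ + 1) * density Z)) / (p + (γ - 1) / (γ + 1) * pressure γ Z))
  else
    2 * soundSpeed γ Z / (γ - 1) * ((p / pressure γ Z) ^ ((γ - 1) / (2 * γ)) - 1)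

/-- Pressure between the two genuinely nonlinear waves: the root of the increasing function
`p ↦ f_L(p) + f_R(p) + v_R - v_L` on `[0, ∞)`, and `0` if there is none (vacuum). -/
def starPressure (γ : ℝ) (n : Pt d) (UL UR : State d) : ℝ :=
  sInf {p : ℝ | 0 ≤ p ∧
    0 ≤ waveCurve γ UL p + waveCurve γ UR p + normalVelocity n UR - normalVelocity n UL}

/-- Speed, relative to the fluid in the state `Z`, of the outer edge of the wave joining `Z` to a
state of pressure `p`: the shock speed if `p > p_Z`, the speed of sound otherwise. -/
def outerWaveSpeed (γ : ℝ) (Z : State d) (p : ℝ) : ℝ :=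
  soundSpeed γ Z *
    √(1 + (γ + 1) / (2 * γ) * (max (p - pressure γ Z) 0 / pressure γ Z))

/-- Maximum wave speed in the Riemann problem with left state `UL`, right state `UR` and
flux `f(·) n`. -/
def maxWaveSpeed (γ : ℝ) (UL UR : State d) (n : Pt d) : ℝ :=
  max |normalVelocity n UL - outerWaveSpeed γ UL (starPressure γ n UL UR)|
      |normalVelocity n UR + outerWaveSpeed γ UR (starPressure γ n UL UR)|

/-- `(density, normal velocity, pressure)` at `x/t = 0` of the part of the Riemann solution lying
to the left of the contact wave, for left data of density `ρ`, normal velocity `v`, pressure `p`,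
sound speed `a`; `ps` is the pressure, and `vs` the normal velocity, behind the left wave. -/
def sampleLeft (γ ρ v p a ps vs : ℝ) : ℝ × ℝ × ℝ :=
  if p < ps then
    -- the left wave is a shock
    if 0 ≤ v - a * √(1 + (γ + 1) / (2 * γ) * ((ps - p) / p)) then (ρ, v, p)
    else (ρ * ((ps / p + (γ - 1) / (γ + 1)) / ((γ - 1) / (γ + 1) * (ps / p) + 1)), vs, ps)
  else
    -- the left wave is a rarefaction
    if 0 ≤ v - a then (ρ, v, p)
    else if vs - a * (ps / p) ^ ((γ - 1) / (2 * γ)) ≤ 0 then (ρ * (ps / p) ^ (1 / γ), vs, ps)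
    else
      (ρ * (2 / (γ + 1) + (γ - 1) / ((γ + 1) * a) * v) ^ (2 / (γ - 1)),
       2 / (γ + 1) * (a + (γ - 1) / 2 * v),
       p * (2 / (γ + 1) + (γ - 1) / ((γ + 1) * a) * v) ^ (2 * γ / (γ - 1)))

/-- The value at `x = 0` of the solution of the Riemann problem with left state `UL`, right state
`UR` and flux `f(·) n`. The part to the right of the contact wave is obtained from
`sampleLeft` by reflection. When a discontinuity is stationary at `x = 0` one of its two
one-sided values is taken. -/
def riemannAtZero (γ : ℝ) (n : Pt d) (UL UR : State d) : State d :=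
  let ps := starPressure γ n UL UR
  let vL := normalVelocity n UL
  let vR := normalVelocity n UR
  if 0 ≤ (vL + vR) / 2 + (waveCurve γ UR ps - waveCurve γ UL ps) / 2 then
    let w := sampleLeft γ (density UL) vL (pressure γ UL) (soundSpeed γ UL) ps
      (vL - waveCurve γ UL ps)
    ofPrimitive γ w.1 (tangentialVelocity n UL + w.2.1 • n) w.2.2
  else
    let w := sampleLeft γ (density UR) (-vR) (pressure γ UR) (soundSpeed γ UR) ps
      (-vR - waveCurve γ UR ps)
    ofPrimitive γ w.1 (tangentialVelocity n UR - w.2.1 • n) w.2.2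

/-! ### Boundary post-processing of a single state -/

/-- Slip condition: the normal part of the momentum is removed. -/
def slipState (n : Pt d) (U : State d) : State d :=
  (density U, momentum U - inner ℝ (momentum U) n • n, totalEnergy U)

/-- Characteristic variable `C₁ = v·n - 2a/(γ-1)`. -/
def charOne (γ : ℝ) (n : Pt d) (U : State d) : ℝ :=
  normalVelocity n U - 2 * soundSpeed γ U / (γ - 1)

/-- Characteristic variable `C₃ = v·n + 2a/(γ-1)`. -/
def charThree (γ : ℝ) (n : Pt d) (U : State d) : ℝ :=
  normalVelocity n U + 2 * soundSpeed γ U / (γ - 1)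

/-- The subsonic update: `C₁` is that of the Dirichlet state `UD`, `C₃` is that of `U`, and `S`
and the tangential velocity are the given `s` and `vt`. -/
def subsonicState (γ : ℝ) (n : Pt d) (U UD : State d) (s : ℝ) (vt : Pt d) : State d :=
  let ρ := (1 / (γ * s) * ((γ - 1) / 4 * (charThree γ n U - charOne γ n UD)) ^ 2) ^ (1 / (γ - 1))
  let vn := 1 / 2 * (charOne γ n UD + charThree γ n U)
  ofPrimitive γ ρ (vt + vn • n) (s * ρ ^ γ)

/-- Non-reflecting post-processing through the characteristic variables. -/
def characteristicState (γ : ℝ) (n : Pt d) (U UD : State d) : State d :=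
  if normalVelocity n U + soundSpeed γ U < 0 then
    -- supersonic inflow
    UD
  else if normalVelocity n U < 0 then
    -- subsonic inflow
    subsonicState γ n U UD (entropyS γ UD) (tangentialVelocity n UD)
  else if normalVelocity n U - soundSpeed γ U < 0 then
    -- subsonic outflow
    subsonicState γ n U UD (entropyS γ U) (tangentialVelocity n U)
  else
    -- supersonic outflow
    U

/-- The admissibility condition on the Dirichlet state used with the characteristic variables:
`γ ≤ 3` and `½ (γ-1) v·n ≤ a`, the last inequality being strict in the limit case `γ = 3`. -/
def CharacteristicDataOK (γ : ℝ) (n : Pt d) (UD : State d) : Prop :=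
  γ ≤ 3 ∧ (γ - 1) / 2 * normalVelocity n UD ≤ soundSpeed γ UD ∧
    (γ = 3 → (γ - 1) / 2 * normalVelocity n UD < soundSpeed γ UD)

/-- If the Riemann solution with left state `U` and right state `UD` contains vacuum, the vacuum
region is the sector `C₃(U) ≤ x/t ≤ C₁(UD)`. This says that `x = 0` does not lie in it. -/
def NoVacuumAtZero (γ : ℝ) (n : Pt d) (U UD : State d) : Prop :=
  ¬ (charThree γ n U ≤ 0 ∧ 0 ≤ charOne γ n UD)

/-! ### Domain, outward normal, shape functions -/

/-- Bounded polyhedral domains: bounded, connected, open, lying locally on one side of the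
boundary, and with boundary contained in finitely many hyperplanes. -/
structure IsPolyhedralDomain (D : Set (Pt d)) : Prop where
  isOpen : IsOpen D
  isConnected : IsConnected D
  isBounded : Bornology.IsBounded D
  regular : interior (closure D) = D
  flat : ∃ H : Finset (Pt d × ℝ), (∀ h ∈ H, h.1 ≠ 0) ∧
    frontier D ⊆ ⋃ h ∈ H, {x | inner ℝ h.1 x = h.2}

/-- `ν` is the outward unit normal of `D` at a point `x` at which the boundary is flat. -/
def IsOutwardNormal (D : Set (Pt d)) (x ν : Pt d) : Prop :=
  ‖ν‖ = 1 ∧ ∃ r > 0, ∀ y ∈ Metric.ball x r, (y ∈ D ↔ inner ℝ ν (y - x) < 0)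

open Classical in
/-- The outward unit normal field of a polyhedral domain (defined almost everywhere on the
boundary, namely off the edges; set to zero elsewhere). -/
def outwardNormal (D : Set (Pt d)) (x : Pt d) : Pt d :=
  if h : ∃ ν, IsOutwardNormal D x ν then h.choose else 0

/-- The finite element setting: a bounded polyhedral domain, the shape functions (indexed by the
degrees of freedom `V`), and the part of the boundary where slip is imposed. Continuous (mapped)
Lagrange shape functions on a mesh covering the domain are Lipschitz; only the properties listed
are required of them. -/
structure Setting (d : ℕ) (V : Type*) [Fintype V] where
  dom : Set (Pt d)
  polyhedral : IsPolyhedralDomain dom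
  shape : V → Pt d → ℝ
  shape_lipschitz : ∀ i, ∃ K : NNReal, LipschitzOnWith K (shape i) (closure dom)
  shape_nonneg : ∀ i, ∀ x ∈ closure dom, 0 ≤ shape i x
  shape_sum : ∀ x ∈ closure dom, ∑ i, shape i x = 1
  shape_ne_zero : ∀ i, ∃ x ∈ dom, shape i x ≠ 0
  slipBdry : Set (Pt d)
  slipBdry_subset : slipBdry ⊆ frontier dom
  slipBdry_measurable : MeasurableSet slipBdry

namespace Setting

variable {V : Type*} [Fintype V] (S : Setting d V)

/-- The non-reflecting part of the boundary. -/
def nrBdry : Set (Pt d) := frontier S.dom \ S.slipBdry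

/-- Support of a shape function. -/
def supp (i : V) : Set (Pt d) := closure {x | x ∈ S.dom ∧ S.shape i x ≠ 0}

open Classical in
/-- The stencil `I(i)`. -/
def stencil (i : V) : Finset V :=
  Finset.univ.filter fun j => volume (S.supp j ∩ S.supp i) ≠ 0

open Classical in
/-- The punctured stencil `I(i) \ {i}`. -/
def pstencil (i : V) : Finset V := (S.stencil i).erase i

/-- Lumped mass `m_i`. -/
def mass (i : V) : ℝ := ∫ x in S.dom, S.shape i x

/-- Consistent mass matrix `m_ij`. -/
def massMat (i j : V) : ℝ := ∫ x in S.dom, S.shape i x * S.shape j x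

/-- `c_ij = ∫_D φ_i ∇φ_j`. -/
def c (i j : V) : Pt d := ∫ x in S.dom, S.shape i x • ∇ (S.shape j) x

/-- `n_ij = c_ij / ‖c_ij‖`. -/
def nvec (i j : V) : Pt d := ‖S.c i j‖⁻¹ • S.c i j

open Classical in
/-- `b_ij = δ_ij - m_ij / m_j`. -/
def b (i j : V) : ℝ := (if i = j then 1 else 0) - S.massMat i j / S.mass j

/-- Boundary degrees of freedom seeing the slip boundary. -/
def slipDofs : Set V := {i | ∃ x ∈ S.slipBdry, S.shape i x ≠ 0}

/-- Boundary degrees of freedom seeing the non-reflecting boundary. -/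
def nrDofs : Set V := {i | ∃ x ∈ S.nrBdry, S.shape i x ≠ 0}

/-- `∫_Γ φ_i n ds` for a part `Γ` of the boundary. -/
def bdryIntegral (Γ : Set (Pt d)) (i : V) : Pt d :=
  ∫ x in Γ, S.shape i x • outwardNormal S.dom x ∂(μHE[d - 1])

/-- The normal vector at `i` associated with the slip boundary. -/
def slipNormal (i : V) : Pt d :=
  ‖S.bdryIntegral S.slipBdry i‖⁻¹ • S.bdryIntegral S.slipBdry i

/-- The normal vector at `i` associated with the non-reflecting boundary. -/
def nrNormal (i : V) : Pt d :=
  ‖S.bdryIntegral S.nrBdry i‖⁻¹ • S.bdryIntegral S.nrBdry i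

end Setting

/-! ### The scheme -/

/-- The user-chosen ingredients of the hyperbolic step. -/
structure Scheme (d : ℕ) (V : Type*) [Fintype V] extends Setting d V where
  /-- adiabatic exponent of the `γ`-law -/
  γ : ℝ
  /-- estimate `λ^max(U_L, U_R, n)` of the maximum wave speed -/
  waveSpeed : State d → State d → Pt d → ℝ
  /-- entropy production indicator `α_i` of a given discrete state -/
  indicator : (V → State d) → V → ℝ
  /-- limiter: `limiter U P ρmin ρmax Φmin` -/
  limiter : State d → State d → ℝ → ℝ → ℝ → ℝ
  /-- number of limiter passes -/
  passes : ℕ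
  /-- the non-reflecting nodes treated with Godunov's method; the characteristic variables are
  used at the other ones -/
  godunov : Set V
  /-- the nodes of both boundary types where slip is applied before (rather than after) the
  non-reflecting post-processing -/
  slipFirst : Set V
  /-- the (time-dependent) Dirichlet states -/
  dirichlet : ℝ → V → State d

/-- The largest `ℓ ∈ [0,1]` such that `U + ℓ P` satisfies the local bounds on the density and on
the functional `Φ`. -/
def largestLimiter (γ : ℝ) (U P : State d) (ρmin ρmax Φmin : ℝ) : ℝ :=
  sSup {l : ℝ | l ∈ Set.Icc 0 1 ∧ ρmin ≤ density (U + l • P) ∧ density (U + l • P) ≤ ρmax ∧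
    Φmin ≤ entropyPhi γ (U + l • P)}

namespace Scheme

variable {V : Type*} [Fintype V] (H : Scheme d V)

/-- Off-diagonal graph viscosity. -/
def dOff (U : V → State d) (i j : V) : ℝ :=
  max (H.waveSpeed (U i) (U j) (H.nvec i j) * ‖H.c i j‖)
    (H.waveSpeed (U j) (U i) (H.nvec j i) * ‖H.c j i‖)

open Classical in
/-- Low-order graph viscosity `d^L_ij`, with diagonal entries `-∑_{j ∈ I*(i)} d^L_ij`. -/
def dLow (U : V → State d) (i j : V) : ℝ :=
  if i = j then -∑ k ∈ H.pstencil i, H.dOff U i k else H.dOff U i j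

/-- `τ ≤ c_cfl min_i (- m_i / (2 d^L_ii))`, multiplied out so that a vanishing `d^L_ii` puts no
restriction on `τ`. -/
def CFL (ccfl τ : ℝ) (U : V → State d) : Prop :=
  ∀ i, 2 * τ * (-H.dLow U i i) ≤ ccfl * H.mass i

/-- Low-order fluxes `F^L_ij`. -/
def fluxLow (U : V → State d) (i j : V) : State d :=
  -flux H.γ (U j) (H.c i j) + H.dLow U i j • (U j - U i)

/-- Low-order update. -/
def lowOrder (τ : ℝ) (U : V → State d) (i : V) : State d :=
  U i + (τ / H.mass i) • ∑ j ∈ H.stencil i, H.fluxLow U i j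

/-- Auxiliary (bar) states. -/
def barState (U : V → State d) (i j : V) : State d :=
  (1 / 2 : ℝ) • (U i + U j) -
    (1 / (2 * H.dLow U i j)) • (flux H.γ (U j) (H.c i j) - flux H.γ (U i) (H.c i j))

/-- High-order graph viscosity. -/
def dHigh (U : V → State d) (i j : V) : ℝ :=
  (H.indicator U i + H.indicator U j) / 2 * H.dLow U i j

/-- High-order fluxes `F^H_i`. -/
def fluxHigh (U : V → State d) (i : V) : State d :=
  ∑ j ∈ H.stencil i, (-flux H.γ (U j) (H.c i j) + H.dHigh U i j • (U j - U i))

/-- `λ_i = (card I(i) - 1)⁻¹`. -/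
def limWeight (i : V) : ℝ := (((H.stencil i).card : ℝ) - 1)⁻¹

/-- The antidiffusive increments `P_ij`. -/
def increment (τ : ℝ) (U : V → State d) (i j : V) : State d :=
  (τ / (H.mass i * H.limWeight i)) •
    (H.b i j • H.fluxHigh U j - H.b j i • H.fluxHigh U i
      + (H.dHigh U i j - H.dLow U i j) • (U j - U i))

/-- Local lower bound on the density. -/
def rhoMin (U : V → State d) (i : V) : ℝ := ⨅ j : H.stencil i, density (H.barState U i j)

/-- Local upper bound on the density. -/
def rhoMax (U : V → State d) (i : V) : ℝ := ⨆ j : H.stencil i, density (H.barState U i j)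

/-- Local lower bound on `Φ`. -/
def phiMin (U : V → State d) (i : V) : ℝ := ⨅ j : H.stencil i, entropyPhi H.γ (U j)

/-- The limiter `ℓ^i_j` computed at node `i` from the current limited state `W`, the current
increments `P`, and the local bounds given by the state `U`. -/
def nodeLimiter (U W : V → State d) (P : V → V → State d) (i j : V) : ℝ :=
  H.limiter (W i) (P i j) (H.rhoMin U i) (H.rhoMax U i) (H.phiMin U i)

/-- The symmetrized limiter `ℓ_ij = min (ℓ^i_j, ℓ^j_i)`. -/
def edgeLimiter (U W : V → State d) (P : V → V → State d) (i j : V) : ℝ :=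
  min (H.nodeLimiter U W P i j) (H.nodeLimiter U W P j i)

/-- One limiter pass: updates the limited state and the remaining increments. -/
def limiterPass (U : V → State d) (WP : (V → State d) × (V → V → State d)) :
    (V → State d) × (V → V → State d) :=
  (fun i => WP.1 i +
      ∑ j ∈ H.pstencil i, (H.limWeight i * H.edgeLimiter U WP.1 WP.2 i j) • WP.2 i j,
   fun i j => (1 - H.edgeLimiter U WP.1 WP.2 i j) • WP.2 i j)

/-- One forward-Euler step: low-order update followed by the limiter passes. -/
def eulerStep (τ : ℝ) (U : V → State d) : V → State d :=
  ((H.limiterPass U)^[H.passes] (H.lowOrder τ U, H.increment τ U)).1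

/-- Non-reflecting post-processing at node `i` and time `t`. -/
def nrState (t : ℝ) (i : V) (U : State d) : State d :=
  open Classical in
  if i ∈ H.godunov then riemannAtZero H.γ (H.nrNormal i) U (H.dirichlet t i)
  else characteristicState H.γ (H.nrNormal i) U (H.dirichlet t i)

open Classical in
/-- The state handed to the non-reflecting post-processing at node `i`. -/
def beforeNr (i : V) (U : State d) : State d :=
  if i ∈ H.slipDofs ∧ i ∈ H.slipFirst then slipState (H.slipNormal i) U else U

open Classical in
/-- Boundary post-processing at time `t`. -/
def bcUpdate (t : ℝ) (W : V → State d) (i : V) : State d :=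
  if i ∈ H.nrDofs then
    if i ∈ H.slipDofs ∧ i ∉ H.slipFirst then
      slipState (H.slipNormal i) (H.nrState t i (H.beforeNr i (W i)))
    else H.nrState t i (H.beforeNr i (W i))
  else if i ∈ H.slipDofs then slipState (H.slipNormal i) (W i)
  else W i

/-- First SSPRK(3,3) stage before post-processing. -/
def preStage1 (τ : ℝ) (U : V → State d) : V → State d := H.eulerStep τ U

def stage1 (t τ : ℝ) (U : V → State d) : V → State d :=
  H.bcUpdate (t + τ) (H.preStage1 τ U)

/-- Second SSPRK(3,3) stage before post-processing. -/
def preStage2 (t τ : ℝ) (U : V → State d) : V → State d := fun i =>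
  (3 / 4 : ℝ) • U i + (1 / 4 : ℝ) • H.eulerStep τ (H.stage1 t τ U) i

def stage2 (t τ : ℝ) (U : V → State d) : V → State d :=
  H.bcUpdate (t + τ / 2) (H.preStage2 t τ U)

/-- Final SSPRK(3,3) stage before post-processing. -/
def preStage3 (t τ : ℝ) (U : V → State d) : V → State d := fun i =>
  (1 / 3 : ℝ) • U i + (2 / 3 : ℝ) • H.eulerStep τ (H.stage2 t τ U) i

/-- The solution at the end of the SSPRK(3,3) step from `t` to `t + τ`. -/
def ssprk3 (t τ : ℝ) (U : V → State d) : V → State d :=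
  H.bcUpdate (t + τ) (H.preStage3 t τ U)

/-- At the non-reflecting nodes treated with Godunov's method, the Riemann solution used to
post-process `W` at time `t` has no vacuum at `x = 0`. -/
def GodunovNoVacuum (t : ℝ) (W : V → State d) : Prop :=
  ∀ i ∈ H.nrDofs, i ∈ H.godunov →
    NoVacuumAtZero H.γ (H.nrNormal i) (H.beforeNr i (W i)) (H.dirichlet t i)

end Scheme

end EulerFE

end

/-! Admissible states form a convex cone, the interior `ρ > 0`, `‖M‖² < 2ρE` of a second-order cone.
Every operation of the scheme is either a convex combination of admissible states or a pointwise map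
that visibly keeps density and pressure positive.

Because `∑ c_ij = 0`, the low-order update is, under the CFL condition, a convex combination of bar
states (`lowOrder_mem_admissible`). A bar state is a positive multiple of the sum of `d U_i + f(U_i)
c` and `d U_j - f(U_j) c`. Each summand lies in the cone as soon as `d` exceeds the acoustic speed
in its direction (`smul_add_flux_mem_admissible`), so no averaging of Riemann solutions is needed. A
limiter pass averages the states `W_i + ℓ_ij P_ij`, which are admissible because the limiter bounds
on `ρ` and `Φ` are positive (`limiterPass_mem_admissible`).

At the boundary, slip only removes kinetic energy, and the non-reflecting states have positive
density and pressure once vacuum is excluded (`riemannAtZero_mem_admissible`,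
`charOne_lt_charThree`). The Runge–Kutta stages are convex combinations of such states. -/

namespace EulerFE

/-! ### The admissible set is a convex cone -/

section States

variable {d : ℕ} {γ : ℝ} {U W : State d} {n c : Pt d}

lemma specificInternalEnergy_eq (hρ : 0 < density U) :
    specificInternalEnergy U =
      (2 * density U * totalEnergy U - ‖momentum U‖ ^ 2) / (2 * density U ^ 2) := by
  unfold specificInternalEnergy velocity
  rw [norm_smul, Real.norm_eq_abs, abs_of_pos (inv_pos.2 hρ)]
  field_simp

/-- This form has no quotients and is homogeneous of degree two, which makes the cone structure
accessible. -/
lemma mem_admissible_iff :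
    U ∈ admissible d ↔ 0 < U.1 ∧ ‖U.2.1‖ ^ 2 < 2 * U.1 * U.2.2 := by
  refine and_congr_right fun hρ => ?_
  rw [specificInternalEnergy_eq hρ, div_pos_iff_of_pos_right (by positivity), sub_pos]
  rfl

lemma mem_admissible_iff_internalEnergy :
    U ∈ admissible d ↔ 0 < density U ∧ 0 < internalEnergy U := by
  rw [mem_admissible_iff]
  refine and_congr_right fun hρ => ?_
  change 0 < U.1 at hρ
  change _ ↔ 0 < U.2.2 - ‖U.2.1‖ ^ 2 / (2 * U.1)
  rw [sub_pos, div_lt_iff₀ (by positivity)]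
  constructor <;> intro h <;> linarith

lemma smul_mem_admissible (hU : U ∈ admissible d) {r : ℝ} (hr : 0 < r) :
    r • U ∈ admissible d := by
  rw [mem_admissible_iff] at hU ⊢
  obtain ⟨h1, h2⟩ := hU
  refine ⟨mul_pos hr h1, ?_⟩
  change ‖r • U.2.1‖ ^ 2 < 2 * (r * U.1) * (r * U.2.2)
  rw [norm_smul, Real.norm_eq_abs, mul_pow, sq_abs]
  have := mul_lt_mul_of_pos_left h2 (pow_pos hr 2)
  linarith

lemma add_mem_admissible (hU : U ∈ admissible d) (hW : W ∈ admissible d) :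
    U + W ∈ admissible d := by
  rw [mem_admissible_iff] at hU hW ⊢
  obtain ⟨h1, h2⟩ := hU
  obtain ⟨k1, k2⟩ := hW
  refine ⟨add_pos h1 k1, ?_⟩
  change ‖U.2.1 + W.2.1‖ ^ 2 < 2 * (U.1 + W.1) * (U.2.2 + W.2.2)
  set x := ‖U.2.1‖
  set y := ‖W.2.1‖
  have hx : 0 ≤ x := norm_nonneg _
  have hy : 0 ≤ y := norm_nonneg _
  have hxy : ‖U.2.1 + W.2.1‖ ^ 2 ≤ (x + y) ^ 2 :=
    pow_le_pow_left₀ (norm_nonneg _) (norm_add_le _ _) 2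
  -- Joint convexity of `m² / ρ` with denominators cleared; the gap is exactly the square passed to
  -- `nlinarith`.
  have key : (x + y) ^ 2 * (U.1 * W.1) ≤ (U.1 + W.1) * (x ^ 2 * W.1 + y ^ 2 * U.1) := by
    nlinarith [sq_nonneg (x * W.1 - y * U.1)]
  have hb : x ^ 2 * W.1 + y ^ 2 * U.1 < 2 * (U.2.2 + W.2.2) * (U.1 * W.1) := by
    have a1 := mul_lt_mul_of_pos_right h2 k1
    have a2 := mul_lt_mul_of_pos_right k2 h1
    linarith
  have hs : 0 < U.1 + W.1 := add_pos h1 k1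
  have hp : 0 < U.1 * W.1 := mul_pos h1 k1
  have := mul_lt_mul_of_pos_left hb hs
  have h3 : (x + y) ^ 2 * (U.1 * W.1) < 2 * (U.1 + W.1) * (U.2.2 + W.2.2) * (U.1 * W.1) := by
    linarith
  exact hxy.trans_lt (lt_of_mul_lt_mul_right h3 hp.le)

lemma convex_admissible : Convex ℝ (admissible d) := by
  intro U hU W hW a b ha hb hab
  rcases ha.eq_or_lt with rfl | ha
  · obtain rfl : b = 1 := by linarith
    simpa using hW
  rcases hb.eq_or_lt with rfl | hb
  · obtain rfl : a = 1 := by linarith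
    simpa using hU
  exact add_mem_admissible (smul_mem_admissible hU ha) (smul_mem_admissible hW hb)

/-! ### Positivity of pressure, sound speed and entropies -/

lemma pressure_eq (hρ : 0 < density U) :
    2 * density U * pressure γ U =
      (γ - 1) * (2 * density U * totalEnergy U - ‖momentum U‖ ^ 2) := by
  rw [pressure, specificInternalEnergy_eq hρ]
  field_simp

lemma pressure_pos (hγ : 1 < γ) (hU : U ∈ admissible d) : 0 < pressure γ U :=
  mul_pos (mul_pos (sub_pos.2 hγ) hU.1) hU.2

lemma soundSpeed_sq (hγ : 1 < γ) (hU : U ∈ admissible d) :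
    soundSpeed γ U ^ 2 = γ * pressure γ U / density U := by
  have := pressure_pos hγ hU
  have := hU.1
  exact Real.sq_sqrt (by positivity)

lemma soundSpeed_pos (hγ : 1 < γ) (hU : U ∈ admissible d) : 0 < soundSpeed γ U := by
  have := pressure_pos hγ hU
  have := hU.1
  exact Real.sqrt_pos.2 (by positivity)

lemma entropyS_pos (hγ : 1 < γ) (hU : U ∈ admissible d) : 0 < entropyS γ U :=
  mul_pos (Real.rpow_pos_of_pos hU.1 _) (pressure_pos hγ hU)

lemma entropyPhi_pos (hU : U ∈ admissible d) : 0 < entropyPhi γ U :=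
  mul_pos (mem_admissible_iff_internalEnergy.1 hU).2 (Real.rpow_pos_of_pos hU.1 _)

lemma mem_admissible_of_entropyPhi_pos (hρ : 0 < density U) (hΦ : 0 < entropyPhi γ U) :
    U ∈ admissible d :=
  mem_admissible_iff_internalEnergy.2
    ⟨hρ, pos_of_mul_pos_left hΦ (Real.rpow_pos_of_pos hρ _).le⟩

lemma ofPrimitive_mem_admissible (hγ : 1 < γ) {ρ p : ℝ} (hρ : 0 < ρ) (hp : 0 < p) (v : Pt d) :
    ofPrimitive γ ρ v p ∈ admissible d := by
  rw [mem_admissible_iff]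
  refine ⟨hρ, ?_⟩
  change ‖ρ • v‖ ^ 2 < 2 * ρ * (p / (γ - 1) + 1 / 2 * ‖ρ • v‖ ^ 2 / ρ)
  have h1 : 0 < ρ * (p / (γ - 1)) := mul_pos hρ (div_pos hp (sub_pos.2 hγ))
  have h2 : 2 * ρ * (p / (γ - 1) + 1 / 2 * ‖ρ • v‖ ^ 2 / ρ) =
      2 * (ρ * (p / (γ - 1))) + ‖ρ • v‖ ^ 2 := by
    field_simp
  linarith

/-! ### Boundary post-processing -/

/-- Pythagoras for a normalized vector. The case `x = 0` is included: the normal is then `0` and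
nothing is removed. -/
lemma norm_sub_normal_part_sq_le (w x : Pt d) :
    ‖w - inner ℝ w (‖x‖⁻¹ • x) • (‖x‖⁻¹ • x)‖ ^ 2 ≤ ‖w‖ ^ 2 := by
  rcases eq_or_ne x 0 with rfl | hx
  · simp
  have hn : ‖‖x‖⁻¹ • x‖ = 1 := norm_smul_inv_norm (𝕜 := ℝ) hx
  rw [norm_sub_sq_real, norm_smul, hn, inner_smul_right, Real.norm_eq_abs, mul_one, sq_abs]
  nlinarith [sq_nonneg (inner ℝ w (‖x‖⁻¹ • x))]

lemma slipState_mem_admissible (hU : U ∈ admissible d) (x : Pt d) :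
    slipState (‖x‖⁻¹ • x) U ∈ admissible d := by
  rw [mem_admissible_iff] at hU ⊢
  exact ⟨hU.1, (norm_sub_normal_part_sq_le U.2.1 x).trans_lt hU.2⟩

lemma subsonicState_mem_admissible (hγ : 1 < γ) {UD : State d} {s : ℝ} (hs : 0 < s)
    (hC : charOne γ n UD < charThree γ n U) (vt : Pt d) :
    subsonicState γ n U UD s vt ∈ admissible d := by
  have h1 : 0 < γ - 1 := sub_pos.2 hγ
  have h2 : 0 < charThree γ n U - charOne γ n UD := sub_pos.2 hC
  have hρ : 0 < (1 / (γ * s) * ((γ - 1) / 4 * (charThree γ n U - charOne γ n UD)) ^ 2) ^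
      (1 / (γ - 1)) := Real.rpow_pos_of_pos (by positivity) _
  exact ofPrimitive_mem_admissible hγ hρ (mul_pos hs (Real.rpow_pos_of_pos hρ _)) _

/-- The data condition gives `C₁(UD) ≤ 0`, while `C₃(U) = (V + a) + (3 - γ)/(γ - 1) a ≥ 0`. For `γ <
3` the second inequality is strict; for `γ = 3` the extra term vanishes and strictness must come
from the data. -/
lemma charOne_lt_charThree (hγ : 1 < γ) (hU : U ∈ admissible d) {UD : State d}
    (hUD : CharacteristicDataOK γ n UD) (hV : 0 ≤ normalVelocity n U + soundSpeed γ U) :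
    charOne γ n UD < charThree γ n U := by
  obtain ⟨h3, hle, hlt⟩ := hUD
  have h1 : 0 < γ - 1 := sub_pos.2 hγ
  have ha := soundSpeed_pos hγ hU
  have eD : charOne γ n UD =
      ((γ - 1) / 2 * normalVelocity n UD - soundSpeed γ UD) * (2 / (γ - 1)) := by
    unfold charOne; field_simp
  have eU : charThree γ n U =
      (normalVelocity n U + soundSpeed γ U) + (3 - γ) / (γ - 1) * soundSpeed γ U := by
    unfold charThree; field_simp; ring
  have hq : 0 < 2 / (γ - 1) := by positivity
  rcases h3.eq_or_lt with h | h
  · have : charOne γ n UD < 0 := by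
      rw [eD]; exact mul_neg_of_neg_of_pos (sub_neg.2 (hlt h)) hq
    have h0 : (3 - γ) / (γ - 1) * soundSpeed γ U = 0 := by rw [h]; simp
    linarith
  · have : charOne γ n UD ≤ 0 := by
      rw [eD]; exact mul_nonpos_of_nonpos_of_nonneg (sub_nonpos.2 hle) hq.le
    have h0 : 0 < (3 - γ) / (γ - 1) * soundSpeed γ U :=
      mul_pos (div_pos (sub_pos.2 h) h1) ha
    linarith

lemma characteristicState_mem_admissible (hγ : 1 < γ) (hU : U ∈ admissible d) {UD : State d}
    (hUD : UD ∈ admissible d) (hOK : CharacteristicDataOK γ n UD) :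
    characteristicState γ n U UD ∈ admissible d := by
  unfold characteristicState
  split_ifs with h1 h2 h3
  · exact hUD
  · exact subsonicState_mem_admissible hγ (entropyS_pos hγ hUD)
      (charOne_lt_charThree hγ hU hOK (not_lt.1 h1)) _
  · exact subsonicState_mem_admissible hγ (entropyS_pos hγ hU)
      (charOne_lt_charThree hγ hU hOK (not_lt.1 h1)) _
  · exact hU

/-! ### The Riemann problem -/

/-- Only two branches can degenerate: the star region, when `ps = 0`, and the inside of the fan,
when the base of the powers is not positive. -/
lemma sampleLeft_pos (hγ : 1 < γ) {ρ v p a ps vs : ℝ} (hρ : 0 < ρ) (hp : 0 < p) (ha : 0 < a)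
    (hps : 0 ≤ ps)
    (hvs : ps ≤ p → vs = v - 2 * a / (γ - 1) * ((ps / p) ^ ((γ - 1) / (2 * γ)) - 1))
    (hvac : ps = 0 → 0 < vs) :
    0 < (sampleLeft γ ρ v p a ps vs).1 ∧ 0 < (sampleLeft γ ρ v p a ps vs).2.2 := by
  have h1 : 0 < γ - 1 := sub_pos.2 hγ
  have hγ0 : 0 < γ := by linarith
  unfold sampleLeft
  split_ifs with h2 h3 h4 h5
  · exact ⟨hρ, hp⟩
  · have : 0 < ps := hp.trans h2
    exact ⟨by positivity, this⟩
  · exact ⟨hρ, hp⟩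
  · have : 0 < ps := by
      -- For `ps = 0` the sound speed behind the fan is zero, so the branch test reads `vs ≤ 0`,
      -- against `hvac`.
      refine hps.lt_of_ne fun h0 => ?_
      have hvs0 := hvac h0.symm
      rw [← h0, zero_div, Real.zero_rpow (by positivity)] at h5
      linarith
    exact ⟨mul_pos hρ (Real.rpow_pos_of_pos (div_pos this hp) _), this⟩
  · have hw : 0 ≤ (ps / p) ^ ((γ - 1) / (2 * γ)) := Real.rpow_nonneg (by positivity) _
    set w := (ps / p) ^ ((γ - 1) / (2 * γ))
    have hb : 0 < 2 / (γ + 1) + (γ - 1) / ((γ + 1) * a) * v := by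
      have e := hvs (not_lt.1 h2)
      -- This Riemann invariant is constant across the fan, hence equals `vs + 2 a w / (γ - 1)`; the
      -- failed test gives `vs > a w ≥ 0`.
      have h6 : 0 < v + 2 * a / (γ - 1) := by
        have e2 : 2 * a / (γ - 1) * (w - 1) = 2 * a / (γ - 1) * w - 2 * a / (γ - 1) := by ring
        have : 0 ≤ 2 * a / (γ - 1) * w := by positivity
        have : 0 ≤ a * w := by positivity
        linarith
      have h7 : 2 / (γ + 1) + (γ - 1) / ((γ + 1) * a) * v =
          (γ - 1) / ((γ + 1) * a) * (v + 2 * a / (γ - 1)) := by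
        field_simp
        ring
      rw [h7]
      positivity
    exact ⟨mul_pos hρ (Real.rpow_pos_of_pos hb _), mul_pos hp (Real.rpow_pos_of_pos hb _)⟩

lemma waveCurve_of_le {Z : State d} {p : ℝ} (h : p ≤ pressure γ Z) :
    waveCurve γ Z p =
      2 * soundSpeed γ Z / (γ - 1) * ((p / pressure γ Z) ^ ((γ - 1) / (2 * γ)) - 1) :=
  if_neg (not_lt.2 h)

lemma waveCurve_zero (hγ : 1 < γ) (hU : U ∈ admissible d) :
    waveCurve γ U 0 = -(2 * soundSpeed γ U / (γ - 1)) := by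
  have h1 : 0 < γ - 1 := sub_pos.2 hγ
  have hγ0 : 0 < γ := by linarith
  rw [waveCurve_of_le (pressure_pos hγ hU).le, zero_div, Real.zero_rpow (by positivity)]
  ring

lemma starPressure_nonneg (UL UR : State d) : 0 ≤ starPressure γ n UL UR :=
  Real.sInf_nonneg fun _ hp => hp.1

lemma riemannAtZero_mem_admissible (hγ : 1 < γ) (hU : U ∈ admissible d) {UD : State d}
    (hUD : UD ∈ admissible d) (hvac : NoVacuumAtZero γ n U UD) :
    riemannAtZero γ n U UD ∈ admissible d := by
  have hps := starPressure_nonneg (γ := γ) (n := n) U UD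
  unfold riemannAtZero
  simp only
  unfold NoVacuumAtZero charThree charOne at hvac
  split_ifs with h
  · obtain ⟨h1, h2⟩ := sampleLeft_pos hγ (v := normalVelocity n U) (ps := starPressure γ n U UD)
      (vs := normalVelocity n U - waveCurve γ U (starPressure γ n U UD))
      hU.1 (pressure_pos hγ hU) (soundSpeed_pos hγ hU) hps
      (fun hle => by rw [waveCurve_of_le hle]) (fun h0 => by
        -- At zero star pressure the branch test is `C₃(U) + C₁(UD) ≥ 0` and the velocity behind the
        -- left wave is `C₃(U)`. If that were nonpositive, `C₁(UD)` would be nonnegative: vacuum at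
        -- `x = 0`. The other branch is the mirror image.
        rw [h0, waveCurve_zero hγ hU, waveCurve_zero hγ hUD] at h
        rw [h0, waveCurve_zero hγ hU]
        by_contra hcon
        exact hvac ⟨by linarith, by linarith⟩)
    exact ofPrimitive_mem_admissible hγ h1 h2 _
  · obtain ⟨h1, h2⟩ := sampleLeft_pos hγ (v := -normalVelocity n UD)
      (ps := starPressure γ n U UD)
      (vs := -normalVelocity n UD - waveCurve γ UD (starPressure γ n U UD))
      hUD.1 (pressure_pos hγ hUD) (soundSpeed_pos hγ hUD) hps
      (fun hle => by rw [waveCurve_of_le hle]) (fun h0 => by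
        rw [h0, waveCurve_zero hγ hU, waveCurve_zero hγ hUD] at h
        rw [h0, waveCurve_zero hγ hUD]
        by_contra hcon
        exact hvac ⟨by linarith, by linarith⟩)
    exact ofPrimitive_mem_admissible hγ h1 h2 _

/-! ### Wave-speed bounds and the star pressure -/

lemma soundSpeed_le_outerWaveSpeed (hγ : 1 < γ) (hU : U ∈ admissible d) (p : ℝ) :
    soundSpeed γ U ≤ outerWaveSpeed γ U p := by
  have hp := pressure_pos hγ hU
  refine le_mul_of_one_le_right (soundSpeed_pos hγ hU).le (Real.one_le_sqrt.2 ?_)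
  have : 0 ≤ max (p - pressure γ U) 0 := le_max_right _ _
  have : 0 ≤ (γ + 1) / (2 * γ) * (max (p - pressure γ U) 0 / pressure γ U) := by
    have : 0 < γ := by linarith
    positivity
  linarith

/-- The fluid behind a wave lags behind the wave's outer edge. For a rarefaction the curve is
nonpositive; for a shock, squaring reduces the claim to `2(p - q) < (γ + 1)p + (γ - 1)q`. -/
lemma waveCurve_lt_outerWaveSpeed (hγ : 1 < γ) (hU : U ∈ admissible d) {p : ℝ} (h0 : 0 ≤ p) :
    waveCurve γ U p < outerWaveSpeed γ U p := by
  have hp := pressure_pos hγ hU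
  have ha := soundSpeed_pos hγ hU
  have hρ := hU.1
  have h1 : 0 < γ - 1 := sub_pos.2 hγ
  have hγ0 : 0 < γ := by linarith
  rcases le_or_gt p (pressure γ U) with h | h
  · refine lt_of_le_of_lt ?_ (ha.trans_le (soundSpeed_le_outerWaveSpeed hγ hU p))
    rw [waveCurve_of_le h]
    refine mul_nonpos_of_nonneg_of_nonpos (by positivity) (sub_nonpos.2 ?_)
    exact Real.rpow_le_one (by positivity) ((div_le_one hp).2 h) (by positivity)
  · have ho : 0 ≤ outerWaveSpeed γ U p :=
      ha.le.trans (soundSpeed_le_outerWaveSpeed hγ hU p)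
    refine lt_of_pow_lt_pow_left₀ 2 ho ?_
    rw [waveCurve, if_pos h, outerWaveSpeed, mul_pow, mul_pow, soundSpeed_sq hγ hU,
      max_eq_left (sub_pos.2 h).le]
    set q := pressure γ U
    set r := density U
    have hq : 0 < p - q := sub_pos.2 h
    rw [Real.sq_sqrt (by positivity), Real.sq_sqrt (by positivity)]
    have e1 : (p - q) ^ 2 * (2 / ((γ + 1) * r) / (p + (γ - 1) / (γ + 1) * q)) =
        2 * (p - q) ^ 2 / (r * ((γ + 1) * p + (γ - 1) * q)) := by
      field_simp
    have e2 : γ * q / r * (1 + (γ + 1) / (2 * γ) * ((p - q) / q)) =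
        ((γ + 1) * p + (γ - 1) * q) / (2 * r) := by
      field_simp
      ring
    rw [e1, e2, div_lt_div_iff₀ (by positivity) (by positivity)]
    have h3 : 2 * (p - q) < (γ + 1) * p + (γ - 1) * q := by nlinarith
    have h4 : (2 * (p - q)) ^ 2 < ((γ + 1) * p + (γ - 1) * q) ^ 2 :=
      pow_lt_pow_left₀ h3 (by positivity) two_ne_zero
    have := mul_lt_mul_of_pos_right h4 hρ
    linarith

lemma continuousOn_waveCurve (hγ : 1 < γ) (hU : U ∈ admissible d) :
    ContinuousOn (waveCurve γ U) (Set.Ici 0) := by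
  have hp := pressure_pos hγ hU
  have hρ := hU.1
  have h1 : 0 < γ - 1 := sub_pos.2 hγ
  have hγ0 : 0 < γ := by linarith
  unfold waveCurve
  -- With the test turned into `p ≤ p_Z`, the two branches meet only at `p = p_Z`, where both
  -- vanish.
  simp only [← not_le, ite_not]
  refine ContinuousOn.if ?_ ?_ ?_
  · intro p hp'
    have : p = pressure γ U := frontier_le_subset_eq continuous_id continuous_const hp'.2
    subst this
    simp [div_self hp.ne']
  · refine ContinuousOn.mul continuousOn_const (ContinuousOn.sub ?_ continuousOn_const)
    exact ((continuous_id.div_const _).rpow_const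
      fun _ => Or.inr (by positivity)).continuousOn
  · refine ContinuousOn.mul (by fun_prop) (ContinuousOn.sqrt ?_)
    refine ContinuousOn.div continuousOn_const (by fun_prop) fun p hp' => ?_
    have : 0 ≤ p := hp'.1
    positivity

lemma exists_le_waveCurve (hγ : 1 < γ) (hU : U ∈ admissible d) (M : ℝ) :
    ∃ p₀, 0 ≤ p₀ ∧ ∀ p, p₀ ≤ p → M ≤ waveCurve γ U p := by
  have hp := pressure_pos hγ hU
  have hρ := hU.1
  have h1 : 0 < γ - 1 := sub_pos.2 hγ
  have hγ0 : 0 < γ := by linarith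
  set q := pressure γ U with hqdef
  set r := density U with hrdef
  -- for `p ≥ 2q` the curve lies above `√(p / (4 (γ+1) ρ))`
  refine ⟨max (2 * q) (4 * (γ + 1) * r * M ^ 2), (by positivity), fun p hle => ?_⟩
  have hp2 : 2 * q ≤ p := (le_max_left _ _).trans hle
  have hpM : 4 * (γ + 1) * r * M ^ 2 ≤ p := (le_max_right _ _).trans hle
  have hqp : q < p := by linarith
  have hp0 : 0 < p := hp.trans hqp
  rw [waveCurve, if_pos hqp, ← hqdef, ← hrdef]
  refine (le_abs_self M).trans (abs_le_of_sq_le_sq' ?_ (by positivity)).2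
  rw [sq_abs, mul_pow, Real.sq_sqrt (by positivity)]
  have e1 : (p - q) ^ 2 * (2 / ((γ + 1) * r) / (p + (γ - 1) / (γ + 1) * q)) =
      2 * (p - q) ^ 2 / (r * ((γ + 1) * p + (γ - 1) * q)) := by
    field_simp
  rw [e1, le_div_iff₀ (by positivity)]
  have h2 : p ^ 2 ≤ 4 * (p - q) ^ 2 := by nlinarith
  have h3 : r * ((γ + 1) * p + (γ - 1) * q) ≤ 2 * (γ + 1) * r * p := by
    have : (γ - 1) * q ≤ (γ + 1) * p := by nlinarith
    nlinarith
  have h4 : M ^ 2 * (r * ((γ + 1) * p + (γ - 1) * q)) ≤ M ^ 2 * (2 * (γ + 1) * r * p) :=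
    mul_le_mul_of_nonneg_left h3 (sq_nonneg M)
  have h5 := mul_le_mul_of_nonneg_right hpM hp0.le
  nlinarith

/-- Continuity makes the set defining the star pressure closed, and growth of the wave curves makes
it nonempty, so the infimum is attained rather than a default value. -/
lemma starPressure_spec (hγ : 1 < γ) (hU : U ∈ admissible d) (hW : W ∈ admissible d)
    (n : Pt d) :
    0 ≤ waveCurve γ U (starPressure γ n U W) + waveCurve γ W (starPressure γ n U W) +
      normalVelocity n W - normalVelocity n U := by
  set g : ℝ → ℝ := fun p =>
    waveCurve γ U p + waveCurve γ W p + normalVelocity n W - normalVelocity n U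
  have hg : ContinuousOn g (Set.Ici 0) :=
    (((continuousOn_waveCurve hγ hU).add (continuousOn_waveCurve hγ hW)).add
      continuousOn_const).sub continuousOn_const
  have hset : {p : ℝ | 0 ≤ p ∧ 0 ≤ g p} = Set.Ici 0 ∩ g ⁻¹' Set.Ici 0 := rfl
  have hclosed : IsClosed {p : ℝ | 0 ≤ p ∧ 0 ≤ g p} := by
    rw [hset]; exact hg.preimage_isClosed_of_isClosed isClosed_Ici isClosed_Ici
  obtain ⟨p₁, h₁, k₁⟩ := exists_le_waveCurve hγ hU (normalVelocity n U)
  obtain ⟨p₂, h₂, k₂⟩ := exists_le_waveCurve hγ hW (-normalVelocity n W)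
  have hne : {p : ℝ | 0 ≤ p ∧ 0 ≤ g p}.Nonempty := by
    refine ⟨max p₁ p₂, h₁.trans (le_max_left _ _), ?_⟩
    have := k₁ _ (le_max_left p₁ p₂)
    have := k₂ _ (le_max_right p₁ p₂)
    simp only [g]
    linarith
  exact (hclosed.csInf_mem hne ⟨0, fun _ hp => hp.1⟩).2

/-- The extreme waves have distinct speeds, `v_L - s_L < v_L - f_L ≤ v_R + f_R < v_R + s_R`, so they
cannot both be zero. Strictness is what forces `c_ij = 0` whenever the viscosity vanishes. -/
lemma maxWaveSpeed_pos (hγ : 1 < γ) (hU : U ∈ admissible d) (hW : W ∈ admissible d)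
    (n : Pt d) : 0 < maxWaveSpeed γ U W n := by
  have hs := starPressure_spec hγ hU hW n
  have h0 := starPressure_nonneg (γ := γ) (n := n) U W
  have h1 := waveCurve_lt_outerWaveSpeed hγ hU h0
  have h2 := waveCurve_lt_outerWaveSpeed hγ hW h0
  by_contra hcon
  have h3 := (neg_abs_le _).trans' (neg_le_neg ((le_max_left _ _).trans (not_lt.1 hcon)))
  have h4 := (le_abs_self _).trans ((le_max_right _ _).trans (not_lt.1 hcon))
  linarith

lemma soundSpeed_le_maxWaveSpeed_add (hγ : 1 < γ) (hU : U ∈ admissible d) (W : State d)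
    (n : Pt d) : soundSpeed γ U ≤ maxWaveSpeed γ U W n + normalVelocity n U := by
  have h1 := soundSpeed_le_outerWaveSpeed hγ hU (starPressure γ n U W)
  have h2 := (neg_abs_le _).trans' (neg_le_neg (le_max_left
    |normalVelocity n U - outerWaveSpeed γ U (starPressure γ n U W)|
    |normalVelocity n W + outerWaveSpeed γ W (starPressure γ n U W)|))
  unfold maxWaveSpeed
  linarith

lemma soundSpeed_le_maxWaveSpeed_sub (hγ : 1 < γ) (hW : W ∈ admissible d) (U : State d)
    (n : Pt d) : soundSpeed γ W ≤ maxWaveSpeed γ U W n - normalVelocity n W := by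
  have h1 := soundSpeed_le_outerWaveSpeed hγ hW (starPressure γ n U W)
  have h2 := (le_abs_self _).trans (le_max_right
    |normalVelocity n U - outerWaveSpeed γ U (starPressure γ n U W)|
    |normalVelocity n W + outerWaveSpeed γ W (starPressure γ n U W)|)
  unfold maxWaveSpeed
  linarith

/-! ### Bar states -/

lemma flux_zero (γ : ℝ) (U : State d) : flux γ U 0 = 0 := by
  simp [flux]

lemma flux_neg (γ : ℝ) (U : State d) (c : Pt d) : flux γ U (-c) = -flux γ U c := by
  simp only [flux, inner_neg_right, neg_smul, smul_neg, neg_mul, Prod.neg_mk, neg_add]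

lemma flux_add (γ : ℝ) (U : State d) (c c' : Pt d) :
    flux γ U (c + c') = flux γ U c + flux γ U c' := by
  simp only [flux, inner_add_right, add_smul, smul_add, add_mul, Prod.mk_add_mk]
  congr 2
  abel

lemma flux_sum (γ : ℝ) (U : State d) {ι : Type*} (s : Finset ι) (c : ι → Pt d) :
    flux γ U (∑ j ∈ s, c j) = ∑ j ∈ s, flux γ U (c j) :=
  map_sum (AddMonoidHom.mk' (flux γ U) (flux_add γ U)) c s

/-- With `s = r + v·c` the state is `(ρs, sM + pc, sE + (v·c)p)`. The cross terms cancel and the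
cone condition becomes `p²‖c‖² < s²(2ρE - ‖M‖²) = s² · 2ρp/(γ - 1)`. From `s² ≥ a²‖c‖²` the right
side is at least `2γ/(γ - 1)` times the left, a factor above one. -/
lemma smul_add_flux_mem_admissible (hγ : 1 < γ) (hU : U ∈ admissible d) (hc : c ≠ 0) {r : ℝ}
    (h : soundSpeed γ U * ‖c‖ ≤ r + normalVelocity c U) :
    r • U + flux γ U c ∈ admissible d := by
  have hp := pressure_pos hγ hU
  have hρ := hU.1
  have hc' : 0 < ‖c‖ := norm_pos_iff.2 hc
  have h1 : 0 < γ - 1 := sub_pos.2 hγ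
  have hs2 := soundSpeed_sq hγ hU
  have hpe := pressure_eq (γ := γ) hρ
  have hm : inner ℝ (momentum U) c = density U * normalVelocity c U := by
    rw [normalVelocity, velocity, real_inner_smul_left, mul_inv_cancel_left₀ hρ.ne']
  have hv : inner ℝ (velocity U) c = normalVelocity c U := rfl
  set ρ := density U
  set p := pressure γ U
  set w := normalVelocity c U
  have ha : 0 < soundSpeed γ U * ‖c‖ := mul_pos (soundSpeed_pos hγ hU) hc'
  have hs : 0 < r + w := ha.trans_le h
  have hfst : (r • U + flux γ U c).1 = ρ * (r + w) := by
    change r * ρ + inner ℝ (momentum U) c = _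
    rw [hm]; ring
  have hmom : (r • U + flux γ U c).2.1 = (r + w) • momentum U + p • c := by
    change r • momentum U + (inner ℝ (velocity U) c • momentum U + p • c) = _
    rw [hv, add_smul, add_assoc]
  have hen : (r • U + flux γ U c).2.2 = (r + w) * totalEnergy U + w * p := by
    change r * totalEnergy U + inner ℝ (velocity U) c * (totalEnergy U + p) = _
    rw [hv]; ring
  rw [mem_admissible_iff, hfst, hmom, hen]
  refine ⟨mul_pos hρ hs, ?_⟩
  rw [norm_add_sq_real, norm_smul, norm_smul, real_inner_smul_left, real_inner_smul_right, hm,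
    mul_pow, mul_pow, Real.norm_eq_abs, Real.norm_eq_abs, sq_abs, sq_abs]
  have hsq : γ * p / ρ * ‖c‖ ^ 2 ≤ (r + w) ^ 2 := by
    rw [← hs2, ← mul_pow]
    exact pow_le_pow_left₀ ha.le h 2
  have hgap : 2 * ρ * totalEnergy U - ‖momentum U‖ ^ 2 = 2 * ρ * p / (γ - 1) := by
    rw [hpe]; field_simp
  have hk : 0 < 2 * ρ * p / (γ - 1) := by positivity
  have h2 := mul_le_mul_of_nonneg_right hsq hk.le
  have h3 : γ * p / ρ * ‖c‖ ^ 2 * (2 * ρ * p / (γ - 1)) =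
      p ^ 2 * ‖c‖ ^ 2 + p ^ 2 * ‖c‖ ^ 2 * ((γ + 1) / (γ - 1)) := by
    field_simp
    ring
  have h4 : 0 < p ^ 2 * ‖c‖ ^ 2 * ((γ + 1) / (γ - 1)) := by positivity
  have h5 : p ^ 2 * ‖c‖ ^ 2 <
      (r + w) ^ 2 * (2 * ρ * totalEnergy U - ‖momentum U‖ ^ 2) := by
    rw [hgap]; linarith
  nlinarith

end States

/-! ### Shape functions -/

namespace Setting

variable {d : ℕ} {V : Type*} [Fintype V] (S : Setting d V)

lemma measurableSet_dom : MeasurableSet S.dom := S.polyhedral.isOpen.measurableSet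

lemma volume_dom_ne_top : volume S.dom ≠ ⊤ := S.polyhedral.isBounded.measure_lt_top.ne

lemma continuousOn_shape (i : V) : ContinuousOn (S.shape i) S.dom := by
  obtain ⟨K, hK⟩ := S.shape_lipschitz i
  exact hK.continuousOn.mono subset_closure

lemma shape_le_one (i : V) {x : Pt d} (hx : x ∈ closure S.dom) : S.shape i x ≤ 1 := by
  rw [← S.shape_sum x hx]
  exact Finset.single_le_sum (fun j _ => S.shape_nonneg j x hx) (Finset.mem_univ i)

lemma norm_shape_le_one (i : V) {x : Pt d} (hx : x ∈ S.dom) : ‖S.shape i x‖ ≤ 1 := by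
  rw [Real.norm_eq_abs, abs_of_nonneg (S.shape_nonneg i x (subset_closure hx))]
  exact S.shape_le_one i (subset_closure hx)

lemma aestronglyMeasurable_shape (i : V) :
    AEStronglyMeasurable (S.shape i) (volume.restrict S.dom) :=
  (S.continuousOn_shape i).aestronglyMeasurable S.measurableSet_dom

lemma integrableOn_of_norm_le {F : Type*} [NormedAddCommGroup F] {f : Pt d → F}
    (hf : AEStronglyMeasurable f (volume.restrict S.dom)) {M : ℝ}
    (hM : ∀ x ∈ S.dom, ‖f x‖ ≤ M) : IntegrableOn f S.dom := by
  have : IsFiniteMeasure (volume.restrict S.dom) :=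
    ⟨by rw [Measure.restrict_apply_univ]; exact S.volume_dom_ne_top.lt_top⟩
  exact Integrable.of_bound hf M
    ((ae_restrict_mem S.measurableSet_dom).mono fun x hx => hM x hx)

lemma integrableOn_shape (i : V) : IntegrableOn (S.shape i) S.dom :=
  S.integrableOn_of_norm_le (S.aestronglyMeasurable_shape i) fun _ => S.norm_shape_le_one i

lemma isOpen_shape_ne_zero (i : V) : IsOpen {x | x ∈ S.dom ∧ S.shape i x ≠ 0} :=
  (S.continuousOn_shape i).isOpen_inter_preimage S.polyhedral.isOpen isOpen_compl_singleton

lemma volume_shape_ne_zero_pos (i : V) : 0 < volume {x | x ∈ S.dom ∧ S.shape i x ≠ 0} := by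
  obtain ⟨x, hx, hne⟩ := S.shape_ne_zero i
  exact (S.isOpen_shape_ne_zero i).measure_pos volume ⟨x, hx, hne⟩

/-- A shape function is nonnegative and continuous, so being nonzero at one point of the open domain
makes it positive on a set of positive measure. -/
lemma mass_pos (i : V) : 0 < S.mass i := by
  refine (setIntegral_pos_iff_support_of_nonneg_ae ?_ (S.integrableOn_shape i)).2 ?_
  · exact (ae_restrict_mem S.measurableSet_dom).mono
      fun x hx => S.shape_nonneg i x (subset_closure hx)
  · refine (S.volume_shape_ne_zero_pos i).trans_le (measure_mono fun x hx => ?_)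
    exact ⟨hx.2, hx.1⟩

lemma self_mem_stencil (i : V) : i ∈ S.stencil i := by
  refine Finset.mem_filter.2 ⟨Finset.mem_univ _, ?_⟩
  rw [Set.inter_self]
  exact ((S.volume_shape_ne_zero_pos i).trans_le (measure_mono subset_closure)).ne'

lemma gradient_bound (i : V) : ∃ K : ℝ, 0 ≤ K ∧ ∀ x ∈ S.dom, ‖∇ (S.shape i) x‖ ≤ K := by
  obtain ⟨K, hK⟩ := S.shape_lipschitz i
  refine ⟨K, K.2, fun x hx => ?_⟩
  rw [gradient, LinearIsometryEquiv.norm_map]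
  exact norm_fderiv_le_of_lipschitzOn ℝ
    (Filter.mem_of_superset (S.polyhedral.isOpen.mem_nhds hx) subset_closure) hK

lemma measurable_gradient (i : V) : Measurable (∇ (S.shape i)) :=
  (InnerProductSpace.toDual ℝ (Pt d)).symm.continuous.measurable.comp
    (measurable_fderiv ℝ (S.shape i))

lemma integrableOn_shape_smul_gradient (i j : V) :
    IntegrableOn (fun x => S.shape i x • ∇ (S.shape j) x) S.dom := by
  obtain ⟨K, hK0, hK⟩ := S.gradient_bound j
  refine S.integrableOn_of_norm_le (M := K) ((S.aestronglyMeasurable_shape i).smul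
    (S.measurable_gradient j).aestronglyMeasurable) fun x hx => ?_
  rw [norm_smul]
  calc ‖S.shape i x‖ * ‖∇ (S.shape j) x‖ ≤ 1 * K :=
        mul_le_mul (S.norm_shape_le_one i hx) (hK x hx) (norm_nonneg _) zero_le_one
    _ = K := one_mul K

/-- Differentiate the partition of unity. Rademacher's theorem supplies the differentiability: at
other points `fderiv` is `0` by convention and need not be additive. -/
lemma ae_sum_gradient_eq_zero :
    ∀ᵐ x ∂(volume.restrict S.dom), ∑ j, ∇ (S.shape j) x = 0 := by
  have hdiff : ∀ᵐ x ∂(volume.restrict S.dom), ∀ j, DifferentiableWithinAt ℝ (S.shape j) S.dom x := by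
    refine ae_all_iff.2 fun j => ?_
    obtain ⟨K, hK⟩ := S.shape_lipschitz j
    exact (hK.mono subset_closure).ae_differentiableWithinAt S.measurableSet_dom
  filter_upwards [hdiff, ae_restrict_mem S.measurableSet_dom] with x hx hxD
  have hnhds := S.polyhedral.isOpen.mem_nhds hxD
  have hsum : fderiv ℝ (fun y => ∑ j, S.shape j y) x = 0 := by
    have : (fun y => ∑ j, S.shape j y) =ᶠ[nhds x] fun _ => 1 :=
      Filter.mem_of_superset hnhds fun y hy => S.shape_sum y (subset_closure hy)
    rw [this.fderiv_eq]
    exact fderiv_const_apply _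
  rw [fderiv_fun_sum fun j _ => (hx j).differentiableAt hnhds] at hsum
  simp only [gradient]
  rw [← map_sum, hsum, map_zero]

lemma sum_c (i : V) : ∑ j, S.c i j = 0 := by
  unfold c
  rw [← integral_finsetSum _ fun j _ => S.integrableOn_shape_smul_gradient i j]
  refine integral_eq_zero_of_ae ?_
  filter_upwards [S.ae_sum_gradient_eq_zero] with x hx
  rw [← Finset.smul_sum, hx, smul_zero, Pi.zero_apply]

lemma gradient_eq_zero_of_notMem_supp {j : V} {x : Pt d} (hx : x ∈ S.dom) (hj : x ∉ S.supp j) :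
    ∇ (S.shape j) x = 0 := by
  have : S.shape j =ᶠ[nhds x] fun _ => 0 := by
    filter_upwards [S.polyhedral.isOpen.mem_nhds hx,
      isClosed_closure.isOpen_compl.mem_nhds hj] with y hy hys
    by_contra hne
    exact hys (subset_closure ⟨hy, hne⟩)
  rw [gradient, this.fderiv_eq, fderiv_const_apply, map_zero]

/-- The integrand vanishes off the intersection of the two supports, a null set here. -/
lemma c_eq_zero_of_notMem_stencil {i j : V} (hj : j ∉ S.stencil i) : S.c i j = 0 := by
  have hvol : volume (S.supp j ∩ S.supp i) = 0 := by
    by_contra h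
    exact hj (Finset.mem_filter.2 ⟨Finset.mem_univ _, h⟩)
  refine integral_eq_zero_of_ae ?_
  have hae : ∀ᵐ x ∂(volume.restrict S.dom), x ∉ S.supp j ∩ S.supp i :=
    ae_restrict_of_ae (measure_eq_zero_iff_ae_notMem.1 hvol)
  filter_upwards [hae, ae_restrict_mem S.measurableSet_dom] with x hx hxD
  by_cases hxj : x ∈ S.supp j
  · have : S.shape i x = 0 := by
      by_contra hne
      exact hx ⟨hxj, subset_closure ⟨hxD, hne⟩⟩
    simp [this]
  · simp [S.gradient_eq_zero_of_notMem_supp hxD hxj]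

lemma sum_stencil_c (i : V) : ∑ j ∈ S.stencil i, S.c i j = 0 := by
  rw [← S.sum_c i]
  exact Finset.sum_subset (Finset.subset_univ _) fun j _ hj => S.c_eq_zero_of_notMem_stencil hj

end Setting

/-! ### The forward Euler step -/

namespace Scheme

variable {d : ℕ} {V : Type*} [Fintype V] {H : Scheme d V} {U : V → State d}

variable (H) in
lemma sum_stencil_eq_add_sum_pstencil {M : Type*} [AddCommMonoid M] (f : V → M) (i : V) :
    ∑ j ∈ H.stencil i, f j = f i + ∑ j ∈ H.pstencil i, f j := by
  classical
  rw [← Finset.add_sum_erase _ _ (H.self_mem_stencil i), Setting.pstencil]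

lemma ne_of_mem_pstencil {i j : V} (hj : j ∈ H.pstencil i) : i ≠ j := by
  classical
  exact (Finset.ne_of_mem_erase hj).symm

/-- The wave speed estimate bounds the maximum wave speed. -/
def WaveSpeedBound (H : Scheme d V) : Prop :=
  ∀ UL ∈ admissible d, ∀ UR ∈ admissible d, ∀ n : Pt d, ‖n‖ = 1 →
    maxWaveSpeed H.γ UL UR n ≤ H.waveSpeed UL UR n

lemma norm_nvec {i j : V} (hc : H.c i j ≠ 0) : ‖H.nvec i j‖ = 1 :=
  norm_smul_inv_norm (𝕜 := ℝ) hc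

lemma maxWaveSpeed_mul_norm_le_dOff (hspeed : H.WaveSpeedBound) (hU : ∀ i, U i ∈ admissible d)
    {i j : V} (hc : H.c i j ≠ 0) :
    maxWaveSpeed H.γ (U i) (U j) (H.nvec i j) * ‖H.c i j‖ ≤ H.dOff U i j :=
  (mul_le_mul_of_nonneg_right (hspeed _ (hU i) _ (hU j) _ (norm_nvec hc)) (norm_nonneg _)).trans
    (le_max_left _ _)

lemma dOff_nonneg (hγ : 1 < H.γ) (hspeed : H.WaveSpeedBound) (hU : ∀ i, U i ∈ admissible d)
    (i j : V) : 0 ≤ H.dOff U i j := by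
  by_cases hc : H.c i j = 0
  · exact le_max_of_le_left (by rw [hc, norm_zero, mul_zero])
  · exact (mul_nonneg (maxWaveSpeed_pos hγ (hU i) (hU j) _).le (norm_nonneg _)).trans
      (maxWaveSpeed_mul_norm_le_dOff hspeed hU hc)

lemma c_eq_zero_of_dOff_eq_zero (hγ : 1 < H.γ) (hspeed : H.WaveSpeedBound)
    (hU : ∀ i, U i ∈ admissible d) {i j : V} (h : H.dOff U i j = 0) : H.c i j = 0 := by
  by_contra hc
  exact ((mul_pos (maxWaveSpeed_pos hγ (hU i) (hU j) _) (norm_pos_iff.2 hc)).trans_le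
    (maxWaveSpeed_mul_norm_le_dOff hspeed hU hc)).ne' h

lemma normalVelocity_c (i j : V) (W : State d) :
    normalVelocity (H.c i j) W = normalVelocity (H.nvec i j) W * ‖H.c i j‖ := by
  by_cases hc : H.c i j = 0
  · simp [normalVelocity, hc]
  · have : ‖H.c i j‖ ≠ 0 := norm_ne_zero_iff.2 hc
    rw [normalVelocity, normalVelocity, Setting.nvec, inner_smul_right]
    field_simp

lemma dLow_of_ne {i j : V} (h : i ≠ j) : H.dLow U i j = H.dOff U i j := if_neg h

lemma dLow_self (i : V) : H.dLow U i i = -∑ j ∈ H.pstencil i, H.dOff U i j := if_pos rfl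

lemma barState_self (i : V) : H.barState U i i = U i := by
  rw [barState, sub_self, smul_zero, sub_zero, ← two_smul ℝ (U i), smul_smul]
  norm_num

/-- The bar state splits into a left and a right half, each handled by
`smul_add_flux_mem_admissible`, the right one with `-c`. The wave speed bound dominates `a - V` on
the left and `a + V` on the right. -/
lemma barState_mem_admissible (hγ : 1 < H.γ) (hspeed : H.WaveSpeedBound)
    (hU : ∀ i, U i ∈ admissible d) (i j : V) : H.barState U i j ∈ admissible d := by
  rcases eq_or_ne i j with rfl | hij
  · rw [barState_self]; exact hU i
  rw [barState, dLow_of_ne hij]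
  by_cases hc : H.c i j = 0
  · rw [hc, flux_zero, flux_zero, sub_self, smul_zero, sub_zero]
    exact smul_mem_admissible (add_mem_admissible (hU i) (hU j)) (by norm_num)
  have hcn : 0 < ‖H.c i j‖ := norm_pos_iff.2 hc
  have hD := maxWaveSpeed_mul_norm_le_dOff hspeed hU hc
  have hDpos : 0 < H.dOff U i j :=
    (mul_pos (maxWaveSpeed_pos hγ (hU i) (hU j) _) hcn).trans_le hD
  have h1 := mul_le_mul_of_nonneg_right
    (soundSpeed_le_maxWaveSpeed_add hγ (hU i) (U j) (H.nvec i j)) hcn.le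
  have h2 := mul_le_mul_of_nonneg_right
    (soundSpeed_le_maxWaveSpeed_sub hγ (hU j) (U i) (H.nvec i j)) hcn.le
  rw [add_mul, ← normalVelocity_c] at h1
  rw [sub_mul, ← normalVelocity_c] at h2
  have hL : H.dOff U i j • U i + flux H.γ (U i) (H.c i j) ∈ admissible d :=
    smul_add_flux_mem_admissible hγ (hU i) hc (by linarith)
  have hR : H.dOff U i j • U j + flux H.γ (U j) (-H.c i j) ∈ admissible d := by
    refine smul_add_flux_mem_admissible hγ (hU j) (neg_ne_zero.2 hc) ?_
    rw [norm_neg, normalVelocity, inner_neg_right, ← normalVelocity]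
    linarith
  have := smul_mem_admissible (add_mem_admissible hL hR)
    (show 0 < 1 / (2 * H.dOff U i j) by positivity)
  convert this using 1
  rw [flux_neg]
  have e : (1 / 2 : ℝ) = 1 / (2 * H.dOff U i j) * H.dOff U i j := by field_simp
  rw [e]
  module

/-- The added flux `f(U_i) c_ij` sums to zero over the stencil. If the viscosity vanishes, so does
`c_ij`, and both sides are `0`. -/
lemma fluxLow_add_flux (hγ : 1 < H.γ) (hspeed : H.WaveSpeedBound)
    (hU : ∀ i, U i ∈ admissible d) {i j : V} (hij : i ≠ j) :
    H.fluxLow U i j + flux H.γ (U i) (H.c i j) =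
      (2 * H.dOff U i j) • (H.barState U i j - U i) := by
  rw [fluxLow, barState, dLow_of_ne hij]
  by_cases hD : H.dOff U i j = 0
  · rw [hD, c_eq_zero_of_dOff_eq_zero hγ hspeed hU hD, flux_zero, flux_zero]
    simp
  · set D := H.dOff U i j
    have e : (2 * D) • ((1 / (2 * D)) • (flux H.γ (U j) (H.c i j) - flux H.γ (U i) (H.c i j))) =
        flux H.γ (U j) (H.c i j) - flux H.γ (U i) (H.c i j) := by
      rw [smul_smul, mul_one_div_cancel (mul_ne_zero two_ne_zero hD), one_smul]
    rw [smul_sub (2 * D), smul_sub (2 * D) ((1 / 2 : ℝ) • (U i + U j)), e]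
    module

lemma sum_fluxLow (hγ : 1 < H.γ) (hspeed : H.WaveSpeedBound)
    (hU : ∀ i, U i ∈ admissible d) (i : V) :
    ∑ j ∈ H.stencil i, H.fluxLow U i j =
      ∑ j ∈ H.pstencil i, (2 * H.dOff U i j) • (H.barState U i j - U i) := by
  have h0 : ∑ j ∈ H.stencil i, flux H.γ (U i) (H.c i j) = 0 := by
    rw [← flux_sum, H.sum_stencil_c, flux_zero]
  rw [← add_zero (∑ j ∈ H.stencil i, H.fluxLow U i j), ← h0, ← Finset.sum_add_distrib,
    sum_stencil_eq_add_sum_pstencil]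
  have hi : H.fluxLow U i i + flux H.γ (U i) (H.c i i) = 0 := by
    rw [fluxLow, sub_self, smul_zero, add_zero, neg_add_cancel]
  rw [hi, zero_add]
  exact Finset.sum_congr rfl fun j hj => fluxLow_add_flux hγ hspeed hU (ne_of_mem_pstencil hj)

lemma lowOrder_mem_admissible (hγ : 1 < H.γ) (hspeed : H.WaveSpeedBound)
    (hU : ∀ i, U i ∈ admissible d) {ccfl τ : ℝ} (hτ : 0 < τ) (hccfl : ccfl ≤ 1)
    (hcfl : H.CFL ccfl τ U) (i : V) : H.lowOrder τ U i ∈ admissible d := by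
  classical
  have hm := H.mass_pos i
  set w : V → ℝ := fun j => τ / H.mass i * (2 * H.dOff U i j) with hw
  have hw0 : ∀ j, 0 ≤ w j := fun j => by
    have := dOff_nonneg hγ hspeed hU i j
    simp only [hw]
    positivity
  have hsum : ∑ j ∈ H.pstencil i, w j ≤ 1 := by
    have h := hcfl i
    rw [dLow_self, neg_neg] at h
    simp only [hw]
    rw [← Finset.mul_sum, ← Finset.mul_sum, div_mul_eq_mul_div, div_le_one hm]
    nlinarith
  have hlow : H.lowOrder τ U i =
      (1 - ∑ j ∈ H.pstencil i, w j) • U i + ∑ j ∈ H.pstencil i, w j • H.barState U i j := by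
    rw [lowOrder, sum_fluxLow hγ hspeed hU, Finset.smul_sum]
    simp only [smul_smul, smul_sub, Finset.sum_sub_distrib, ← Finset.sum_smul]
    simp only [hw]
    module
  -- The weight left over by the CFL condition goes to the diagonal bar state, which is `U i`.
  set v : V → ℝ := fun j => if j = i then 1 - ∑ j ∈ H.pstencil i, w j else w j with hv
  have hvi : v i = 1 - ∑ j ∈ H.pstencil i, w j := if_pos rfl
  have hvj : ∀ j ∈ H.pstencil i, v j = w j := fun j hj => if_neg (ne_of_mem_pstencil hj).symm
  have hsumv : ∑ j ∈ H.stencil i, v j = 1 := by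
    rw [sum_stencil_eq_add_sum_pstencil, hvi, Finset.sum_congr rfl hvj, sub_add_cancel]
  have hlow' : H.lowOrder τ U i = ∑ j ∈ H.stencil i, v j • H.barState U i j := by
    rw [hlow, sum_stencil_eq_add_sum_pstencil, hvi, barState_self]
    congr 1
    exact Finset.sum_congr rfl fun j hj => by rw [hvj j hj]
  rw [hlow']
  refine convex_admissible.sum_mem (fun j _ => ?_) hsumv
    fun j _ => barState_mem_admissible hγ hspeed hU i j
  simp only [hv]
  split_ifs
  · linarith
  · exact hw0 j

/-! ### The limiter -/

lemma rhoMin_pos (hγ : 1 < H.γ) (hspeed : H.WaveSpeedBound)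
    (hU : ∀ i, U i ∈ admissible d) (i : V) : 0 < H.rhoMin U i := by
  have : Nonempty (H.stencil i) := ⟨⟨i, H.self_mem_stencil i⟩⟩
  obtain ⟨j, hj⟩ := exists_eq_ciInf_of_finite
    (f := fun j : H.stencil i => density (H.barState U i j))
  rw [rhoMin, ← hj]
  exact (barState_mem_admissible hγ hspeed hU i j).1

lemma phiMin_pos (hU : ∀ i, U i ∈ admissible d) (i : V) : 0 < H.phiMin U i := by
  have : Nonempty (H.stencil i) := ⟨⟨i, H.self_mem_stencil i⟩⟩
  obtain ⟨j, hj⟩ := exists_eq_ciInf_of_finite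
    (f := fun j : H.stencil i => entropyPhi H.γ (U j))
  rw [phiMin, ← hj]
  exact entropyPhi_pos (hU j)

end Scheme

/-- The supremum is attained, so the positive lower bounds on `ρ` and `Φ` hold there. `W` itself
need not satisfy the bounds: if no `ℓ` does, the supremum of the empty set is `0` and `W` is kept.
-/
lemma largestLimiter_mem_admissible {d : ℕ} {γ : ℝ} {W P : State d} (hW : W ∈ admissible d)
    {ρmin ρmax Φmin : ℝ} (hρ : 0 < ρmin) (hΦ : 0 < Φmin) :
    W + largestLimiter γ W P ρmin ρmax Φmin • P ∈ admissible d := by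
  set A : Set ℝ := {l : ℝ | l ∈ Set.Icc 0 1 ∧ ρmin ≤ density (W + l • P) ∧
    density (W + l • P) ≤ ρmax ∧ Φmin ≤ entropyPhi γ (W + l • P)} with hA
  change W + sSup A • P ∈ admissible d
  rcases A.eq_empty_or_nonempty with hne | hne
  · rw [hne, Real.sSup_empty, zero_smul, add_zero]
    exact hW
  set ρ : ℝ → ℝ := fun l => density (W + l • P) with hρdef
  have hρc : Continuous ρ := by
    change Continuous fun l : ℝ => W.1 + l * P.1
    fun_prop
  -- `Φ` is continuous only away from zero density, so the density constraint is imposed first.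
  set B : Set ℝ := Set.Icc 0 1 ∩ (ρ ⁻¹' Set.Icc ρmin ρmax) with hB
  have hBc : IsClosed B := isClosed_Icc.inter (isClosed_Icc.preimage hρc)
  have hBρ : ∀ l ∈ B, 0 < ρ l := fun l hl => hρ.trans_le hl.2.1
  have hΦc : ContinuousOn (fun l => entropyPhi γ (W + l • P)) B := by
    have hε : ContinuousOn (fun l : ℝ => (W.2.2 + l * P.2.2) - ‖W.2.1 + l • P.2.1‖ ^ 2 /
        (2 * ρ l)) B := by
      refine ContinuousOn.sub (by fun_prop) (ContinuousOn.div (by fun_prop)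
        (continuous_const.mul hρc).continuousOn fun l hl => ?_)
      have := hBρ l hl
      positivity
    exact hε.mul (hρc.continuousOn.rpow_const fun l hl => Or.inl (hBρ l hl).ne')
  have hAB : A = B ∩ (fun l => entropyPhi γ (W + l • P)) ⁻¹' Set.Ici Φmin := by
    ext l
    simp only [hA, hB, hρdef, Set.mem_ofPred_eq, Set.mem_inter_iff, Set.mem_preimage, Set.mem_Icc,
      Set.mem_Ici]
    tauto
  have hAc : IsClosed A := hAB ▸ hΦc.preimage_isClosed_of_isClosed hBc isClosed_Ici
  have hmem : sSup A ∈ A := hAc.csSup_mem hne ⟨1, fun l hl => hl.1.2⟩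
  exact mem_admissible_of_entropyPhi_pos (hρ.trans_le hmem.2.1) (hΦ.trans_le hmem.2.2.2)

/-- A smaller `ℓ` may violate the limiter bounds but stays on a segment between admissible states.
This permits lower estimates and the symmetrizing minimum. -/
lemma add_smul_mem_admissible {d : ℕ} {W P : State d} (hW : W ∈ admissible d) {l L : ℝ}
    (hL : W + L • P ∈ admissible d) (h0 : 0 ≤ l) (hl : l ≤ L) : W + l • P ∈ admissible d := by
  rcases h0.eq_or_lt with rfl | h0
  · simpa using hW
  have hL0 : 0 < L := h0.trans_le hl
  have := convex_admissible.add_smul_mem hW hL (t := l / L)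
    ⟨by positivity, (div_le_one hL0).2 hl⟩
  rwa [smul_smul, div_mul_cancel₀ _ hL0.ne'] at this

namespace Scheme

variable {d : ℕ} {V : Type*} [Fintype V] {H : Scheme d V} {U : V → State d}

/-- The limiter is nonnegative and does not exceed the largest one. -/
def LimiterBound (H : Scheme d V) : Prop :=
  ∀ (U P : State d) (ρmin ρmax Φmin : ℝ), 0 ≤ H.limiter U P ρmin ρmax Φmin ∧
    H.limiter U P ρmin ρmax Φmin ≤ largestLimiter H.γ U P ρmin ρmax Φmin

variable (H) in
lemma card_pstencil (i : V) : ((H.pstencil i).card : ℝ) = (H.stencil i).card - 1 := by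
  classical
  have h : (H.pstencil i).card + 1 = (H.stencil i).card := by
    rw [Setting.pstencil]
    exact Finset.card_erase_add_one (H.self_mem_stencil i)
  rw [← h]
  push_cast
  ring

lemma limiterPass_mem_admissible (hγ : 1 < H.γ) (hspeed : H.WaveSpeedBound)
    (hlim : H.LimiterBound) (hU : ∀ i, U i ∈ admissible d)
    {WP : (V → State d) × (V → V → State d)} (hW : ∀ i, WP.1 i ∈ admissible d) (i : V) :
    (H.limiterPass U WP).1 i ∈ admissible d := by
  change WP.1 i + ∑ j ∈ H.pstencil i, (H.limWeight i * H.edgeLimiter U WP.1 WP.2 i j) • WP.2 i j ∈ _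
  -- With no neighbours `limWeight` is `0⁻¹ = 0` and the weights do not sum to one, but there is
  -- nothing to add.
  rcases (H.pstencil i).eq_empty_or_nonempty with he | hne
  · rw [he, Finset.sum_empty, add_zero]
    exact hW i
  have hcard : (0 : ℝ) < (H.pstencil i).card := by exact_mod_cast hne.card_pos
  have hlw : H.limWeight i = ((H.pstencil i).card : ℝ)⁻¹ := by
    rw [limWeight, card_pstencil]
  have hsum : ∑ _j ∈ H.pstencil i, H.limWeight i = 1 := by
    rw [Finset.sum_const, nsmul_eq_mul, hlw, mul_inv_cancel₀ hcard.ne']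
  -- The increments are arbitrary here, so the argument applies to every pass.
  have hedge : ∀ j, WP.1 i + H.edgeLimiter U WP.1 WP.2 i j • WP.2 i j ∈ admissible d := fun j =>
    add_smul_mem_admissible (hW i)
      (largestLimiter_mem_admissible (hW i) (rhoMin_pos hγ hspeed hU i) (phiMin_pos hU i))
      (le_min (hlim _ _ _ _ _).1 (hlim _ _ _ _ _).1)
      ((min_le_left _ _).trans (hlim _ _ _ _ _).2)
  have := convex_admissible.sum_mem (t := H.pstencil i) (w := fun _ => H.limWeight i)
    (fun _ _ => by rw [hlw]; positivity) hsum fun j _ => hedge j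
  convert this using 1
  simp only [smul_add, Finset.sum_add_distrib, ← Finset.sum_smul, hsum, one_smul, smul_smul]

lemma eulerStep_mem_admissible (hγ : 1 < H.γ) (hspeed : H.WaveSpeedBound)
    (hlim : H.LimiterBound) (hU : ∀ i, U i ∈ admissible d) {ccfl τ : ℝ} (hτ : 0 < τ)
    (hccfl : ccfl ≤ 1) (hcfl : H.CFL ccfl τ U) (i : V) : H.eulerStep τ U i ∈ admissible d := by
  suffices ∀ k, ∀ i, ((H.limiterPass U)^[k] (H.lowOrder τ U, H.increment τ U)).1 i ∈
      admissible d from this H.passes i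
  intro k
  induction k with
  | zero => exact lowOrder_mem_admissible hγ hspeed hU hτ hccfl hcfl
  | succ k ih =>
    rw [Function.iterate_succ_apply']
    exact limiterPass_mem_admissible hγ hspeed hlim hU ih

/-! ### Boundary conditions and the full step -/

lemma beforeNr_mem_admissible {W : State d} (hW : W ∈ admissible d) (i : V) :
    H.beforeNr i W ∈ admissible d := by
  unfold beforeNr
  split_ifs
  · exact slipState_mem_admissible hW _
  · exact hW

lemma bcUpdate_mem_admissible (hγ : 1 < H.γ)
    (hdir : ∀ (t : ℝ), ∀ i ∈ H.nrDofs, H.dirichlet t i ∈ admissible d)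
    (hchar : ∀ (t : ℝ), ∀ i ∈ H.nrDofs, i ∉ H.godunov →
      CharacteristicDataOK H.γ (H.nrNormal i) (H.dirichlet t i))
    {t : ℝ} {W : V → State d} (hW : ∀ i, W i ∈ admissible d) (hvac : H.GodunovNoVacuum t W)
    (i : V) : H.bcUpdate t W i ∈ admissible d := by
  have hnr : i ∈ H.nrDofs → H.nrState t i (H.beforeNr i (W i)) ∈ admissible d := by
    intro hi
    have hb := beforeNr_mem_admissible (H := H) (hW i) i
    unfold nrState
    split_ifs with hg
    · exact riemannAtZero_mem_admissible hγ hb (hdir t i hi) (hvac i hi hg)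
    · exact characteristicState_mem_admissible hγ hb (hdir t i hi) (hchar t i hi hg)
  unfold bcUpdate
  split_ifs with h1 h2 h3
  · exact slipState_mem_admissible (hnr h1) _
  · exact hnr h1
  · exact slipState_mem_admissible (hW i) _
  · exact hW i

end Scheme

end EulerFE

/-! ### The SSPRK(3,3) step -/

theorem corollary4p3 {d : ℕ} (hd : 1 ≤ d) {V : Type*} [Fintype V] (H : EulerFE.Scheme d V)
    (hγ : 1 < H.γ)
    -- the wave speed estimate is an upper bound on the maximum wave speed
    (hspeed : ∀ UL ∈ EulerFE.admissible d, ∀ UR ∈ EulerFE.admissible d, ∀ n : EulerFE.Pt d,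
      ‖n‖ = 1 → EulerFE.maxWaveSpeed H.γ UL UR n ≤ H.waveSpeed UL UR n)
    (hind : ∀ (U : V → EulerFE.State d) (i : V), H.indicator U i ∈ Set.Icc (0 : ℝ) 1)
    -- the limiter is the largest admissible one or a lower estimate of it
    (hlim : ∀ (U P : EulerFE.State d) (ρmin ρmax Φmin : ℝ),
      0 ≤ H.limiter U P ρmin ρmax Φmin ∧
      H.limiter U P ρmin ρmax Φmin ≤ EulerFE.largestLimiter H.γ U P ρmin ρmax Φmin)
    -- the Dirichlet data
    (hdir : ∀ (t : ℝ), ∀ i ∈ H.nrDofs, H.dirichlet t i ∈ EulerFE.admissible d)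
    (hchar : ∀ (t : ℝ), ∀ i ∈ H.nrDofs, i ∉ H.godunov →
      EulerFE.CharacteristicDataOK H.γ (H.nrNormal i) (H.dirichlet t i))
    -- the time step and the CFL condition at the three stages
    (t τ ccfl : ℝ) (hτ : 0 < τ) (hccfl_pos : 0 < ccfl) (hccfl : ccfl ≤ 1)
    (U : V → EulerFE.State d) (hU : ∀ i, U i ∈ EulerFE.admissible d)
    (hcfl1 : H.CFL ccfl τ U)
    (hcfl2 : H.CFL ccfl τ (H.stage1 t τ U))
    (hcfl3 : H.CFL ccfl τ (H.stage2 t τ U))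
    -- no vacuum in the Riemann problems of Godunov's method
    (hvac1 : H.GodunovNoVacuum (t + τ) (H.preStage1 τ U))
    (hvac2 : H.GodunovNoVacuum (t + τ / 2) (H.preStage2 t τ U))
    (hvac3 : H.GodunovNoVacuum (t + τ) (H.preStage3 t τ U)) :
    ∀ i, H.ssprk3 t τ U i ∈ EulerFE.admissible d := by
  have hstep : ∀ W : V → EulerFE.State d, (∀ i, W i ∈ EulerFE.admissible d) → H.CFL ccfl τ W →
      ∀ i, H.eulerStep τ W i ∈ EulerFE.admissible d := fun W hW hcfl =>
    EulerFE.Scheme.eulerStep_mem_admissible hγ hspeed hlim hW hτ hccfl hcfl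
  have h1 := EulerFE.Scheme.bcUpdate_mem_admissible hγ hdir hchar (hstep U hU hcfl1) hvac1
  have h2 := EulerFE.Scheme.bcUpdate_mem_admissible hγ hdir hchar (fun i =>
    EulerFE.convex_admissible (hU i) (hstep _ h1 hcfl2 i)
      (by norm_num) (by norm_num) (by norm_num)) hvac2
  exact EulerFE.Scheme.bcUpdate_mem_admissible hγ hdir hchar (fun i =>
    EulerFE.convex_admissible (hU i) (hstep _ h2 hcfl3 i)
      (by norm_num) (by norm_num) (by norm_num)) hvac3
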